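/- Let $f\in C^2(\mathbb R)$ and let $a_-<a_0<a_+$, $p>0$, $\mu>0$ be such that: $f$ vanishes exactly at $a_-,a_0,a_+$; $f'(a_\pm)=-p$ and $f'(a_0)=\mu$; $f(u)\le C(1+|u|^q)$ for some $C,q>0$; $f'(u)\le c$ for some $c>0$; $f(u)\le -p(u-a_+)$ for $u\ge a_+$ and $f(u)\ge -p(u-a_-)$ for $u\le a_-$. Assume moreover that $\mu<2p$. Let $\varepsilon_1>0$ and, for $\varepsilon\in(0,\varepsilon_1)$, let $u_0^\varepsilon\in C^2(\mathbb R)$. Assume that there are constants $C_0>1$, $c_0,c_0'>0$, $\kappa_0>1$ and a point $\xi_0\in[-1,1]$, all independent of $\varepsilon$, such that for all $\varepsilon\in(0,\varepsilon_1)$, with $C_\mu:=\min(\mu/4,1)$, - $\|u_0^\varepsilon\|_\infty+\|(u_0^\varepsilon)'\|_\infty+\|(u_0^\varepsilon)''\|_\infty\le C_0$; - $\xi_0$ is the unique point of $[-1,1]$ with $u_0^\varepsilon(\xi_0)=a_0$; - $|u_0^\varepsilon(x)-a_0|\ge c_0\varepsilon^{1/2}$ whenever $|x-\xi_0|\ge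 c_0'\varepsilon^{1/2}$; - $|u_0^\varepsilon(x)-a_+|+|(u_0^\varepsilon)'(x)|+|(u_0^\varepsilon)''(x)|\le \varepsilon^{\kappa_0}C_\mu e^{-\sqrt\mu x/2}$ for $x\ge1$; - $|u_0^\varepsilon(x)-a_-|+|(u_0^\varepsilon)'(x)|+|(u_0^\varepsilon)''(x)|\le \varepsilon^{\kappa_0}C_\mu e^{\sqrt\mu x/2}$ for $x\le-1$. Let $u^\varepsilon$ be the classical solution, bounded on $[0,T]\times\mathbb R$ for every $T>0$, of $$\partial_t u^\varepsilon=\partial_x^2u^\varepsilon+\tfrac1\varepsilon f(u^\varepsilon)\quad(t>0,\ x\in\mathbb R),\qquad u^\varepsilon(0,x)=u_0^\varepsilon(x).$$ Then there exist $K>1$, $\kappa>\frac12$, $C>0$ and $\widetilde C>0$ such that for all sufficiently large $C_1\in(0,\frac1\mu)$ (that is, for all $C_1\in(C_*,\frac1\mu)$ with some $C_*\in(0,\frac1\mu)$) and all $0<\bar\beta<1-C_1\mu$ the following holds for all sufficiently small $\varepsilon>0$, with $t_\varepsilon:=C_1\varepsilon|\log\varepsilon|$: (i) $a_--\varepsilon^\kappa\le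 u^\varepsilon(t_\varepsilon,x)\le a_++\varepsilon^\kappa$ for all $x\in[-K,K]$; (ii) $u^\varepsilon(t_\varepsilon,x)\ge a_+-\varepsilon^\kappa$ for all $x\in[-K,K]$ with $u_0^\varepsilon(x)\ge a_0+C\varepsilon^{\bar\beta}$, and $u^\varepsilon(t_\varepsilon,x)\le a_-+\varepsilon^\kappa$ for all $x\in[-K,K]$ with $u_0^\varepsilon(x)\le a_0-C\varepsilon^{\bar\beta}$; (iii) $|u^\varepsilon(t_\varepsilon,x)-a_+|\le\widetilde C\varepsilon^\kappa e^{-\sqrt\mu x/2}$ for all $x\ge K$, and $|u^\varepsilon(t_\varepsilon,x)-a_-|\le\widetilde C\varepsilon^\kappa e^{\sqrt\mu x/2}$ for all $x\le-K$. -/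

import Mathlib

open Set Filter Topology

/-- Bistable reaction term: `f` is of class `C²`, has exactly the three zeros
`am < a0 < ap`, linearised rates `f'(am) = f'(ap) = -p < 0` and `f'(a0) = μ > 0`,
at most polynomial growth from above, derivative bounded above, and it pulls back at least
linearly (with rate `p`) outside `[am, ap]`. -/
structure IsBistable (f : ℝ → ℝ) (am a0 ap p μ : ℝ) : Prop where
  contDiff : ContDiff ℝ 2 f
  lt_left : am < a0
  lt_right : a0 < ap
  p_pos : 0 < p
  mu_pos : 0 < μ
  zeros : ∀ v : ℝ, f v = 0 ↔ v = am ∨ v = a0 ∨ v = ap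
  deriv_am : deriv f am = -p
  deriv_ap : deriv f ap = -p
  deriv_a0 : deriv f a0 = μ
  growth : ∃ C q : ℝ, 0 < C ∧ 0 < q ∧ ∀ v : ℝ, f v ≤ C * (1 + |v| ^ q)
  deriv_le : ∃ c : ℝ, 0 < c ∧ ∀ v : ℝ, deriv f v ≤ c
  le_of_ge : ∀ v : ℝ, ap ≤ v → f v ≤ -p * (v - ap)
  ge_of_le : ∀ v : ℝ, v ≤ am → -p * (v - am) ≤ f v

/-- Conditions on the initial value `v = u₀^ε` at the parameter `ε`.  The constants
`C0, C, C', κ` and the point `ξ0` do not depend on `ε`. -/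
structure IsInitialValue (am a0 ap μ C0 C C' κ ξ0 ε : ℝ) (v : ℝ → ℝ) : Prop where
  contDiff : ContDiff ℝ 2 v
  /-- The sum of the supremum norms of `v`, `v'` and `v''` is at most `C0`. -/
  bound : ∀ x y z : ℝ, |v x| + |deriv v y| + |deriv (deriv v) z| ≤ C0
  /-- `ξ0` is the unique point of `[-1, 1]` at which `v` takes the value `a0`. -/
  crossing_mem : ξ0 ∈ Icc (-1 : ℝ) 1
  crossing : ∀ x ∈ Icc (-1 : ℝ) 1, v x = a0 ↔ x = ξ0
  away : ∀ x : ℝ, C' * ε ^ (1 / 2 : ℝ) ≤ |x - ξ0| → C * ε ^ (1 / 2 : ℝ) ≤ |v x - a0|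
  right : ∀ x : ℝ, 1 ≤ x →
    |v x - ap| + |deriv v x| + |deriv (deriv v) x|
      ≤ ε ^ κ * min (μ / 4) 1 * Real.exp (-(Real.sqrt μ * x / 2))
  left : ∀ x : ℝ, x ≤ -1 →
    |v x - am| + |deriv v x| + |deriv (deriv v) x|
      ≤ ε ^ κ * min (μ / 4) 1 * Real.exp (Real.sqrt μ * x / 2)

/-- `u : (t, x) ↦ u t x` is the classical solution on `[0, ∞) × ℝ`, bounded on every strip
`[0, T] × ℝ`, of `∂ₜ u = ∂ₓₓ u + ε⁻¹ f(u)` with initial value `v`. -/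
structure IsAllenCahnSolution (f : ℝ → ℝ) (ε : ℝ) (v : ℝ → ℝ) (u : ℝ → ℝ → ℝ) : Prop where
  continuousOn : ContinuousOn (fun q : ℝ × ℝ => u q.1 q.2) (Ici (0 : ℝ) ×ˢ univ)
  bounded : ∀ T : ℝ, ∃ M : ℝ, ∀ t ∈ Icc (0 : ℝ) T, ∀ x : ℝ, |u t x| ≤ M
  initial : ∀ x : ℝ, u 0 x = v x
  contDiff : ∀ t : ℝ, 0 < t → ContDiff ℝ 2 (u t)
  equation : ∀ t : ℝ, 0 < t → ∀ x : ℝ,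
    HasDerivAt (fun s => u s x) (deriv (deriv (u t)) x + 1 / ε * f (u t x)) t

/-!
The solution is bounded below by explicit subsolutions, and above by the same bounds applied to the
reflected solution `-u(t, -x)`, which solves the equation with reaction term `-f(-v)`.

The comparison principle (`nonneg_of_parabolic`, `solution_ge_sub`) is used in the following form.
Let `L` be an upper bound for `f'`, let `b ≥ 0` satisfy `b_t ≥ b_xx + (L / ε) b`, and let `Y` be a
subsolution wherever `u < Y - b`.  Then `u ≥ Y - b` as soon as this holds initially.  The correction
`b` grows like `e^{(L + 1) t / ε}`, that is like a power of `1 / ε` at the time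
`t_ε = C1 ε |log ε|`, but it may be taken exponentially small in the distance divided by
`ε ^ (1 / 2)`.  It thus localises a comparison at a negligible cost on every scale
`ε ^ β` with `β < 1 / 2`.

Three subsolutions are needed.

* `solution_ge_exp`: below `am` the reaction is at least linear with rate `p`, so an initial defect
  with profile `e^{kx}`, `k = 0` or `k = √μ / 2`, is damped by the factor `ε ^ (p C1)`.
* `solution_ge_local`: near a point where the initial value exceeds `a0 + 2 ε ^ β` it exceeds
  `a0 + ε ^ β` on an interval of radius comparable to `ε ^ β`, because it is Lipschitz.  There the
  solution is compared with a spatially constant subsolution `Y` of `Y' = f(Y)`.  Such a `Y` is the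
  inverse of the explicit function `travelTime` (`exists_subflow`); it needs at most a time
  `((2 β / μ) + κ / r) |log ε| + O(1)` to pass from `a0 + ε ^ β` to `ap - ε ^ κ / 2`, for any rate
  `r < p`.
* `solution_ge_right`: for `x ≥ 1` the profile `ap - h e^{-k(x - 1)}` relaxes with rate `r`.

The numbers fit because `μ < 2 p`: there are `κ > 1 / 2` and `r < p` with `κ / r < 1 / μ`.  For `C1`
close to `1 / μ` the admissible `β < 1 - C1 μ` are small, so that `(2 β / μ) + κ / r < C1`; since
`β < 1 - C1 μ`, the condition `3 C1 > 2 / μ + κ / r` suffices.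
-/

/-! ### The comparison principle -/

lemma second_deriv_nonneg_of_isLocalMin {g d : ℝ → ℝ} {m x : ℝ}
    (hg : ∀ y, HasDerivAt g (d y) y) (hd : HasDerivAt d m x) (hx : IsLocalMin g x) : 0 ≤ m := by
  have hdg : deriv g = d := funext fun y => (hg y).deriv
  have hdd : deriv (deriv g) x = m := by rw [hdg]; exact hd.deriv
  by_contra! hm
  have hmax : IsLocalMax g x := by
    refine isLocalMax_of_deriv_deriv_neg (by rw [hdd]; exact hm) ?_ (hg x).continuousAt
    rw [hdg]; exact hx.hasDerivAt_eq_zero (hg x)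
  have hconst : g =ᶠ[𝓝 x] fun _ => g x := by
    filter_upwards [hx, hmax] with y h1 h2 using le_antisymm h2 h1
  have h0 : deriv (deriv g) x = 0 := by
    have h := hconst.deriv.deriv_eq
    simpa using h
  linarith

lemma deriv_nonpos_of_left_min {g : ℝ → ℝ} {m t : ℝ} (ht : 0 < t) (hg : HasDerivAt g m t)
    (hmin : ∀ s ∈ Icc 0 t, g t ≤ g s) : m ≤ 0 := by
  by_contra! hm
  have h1 : ∀ᶠ s in 𝓝[<] t, 0 < slope g t s :=
    (hg.tendsto_slope.mono_left (nhdsWithin_mono _ fun s hs => ne_of_lt hs)).eventually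
      (lt_mem_nhds hm)
  have h2 : ∀ᶠ s in 𝓝[<] t, s ∈ Ioo 0 t := Ioo_mem_nhdsLT ht
  obtain ⟨s, hs, hs'⟩ := (h1.and h2).exists
  rw [slope_def_field] at hs
  have := div_nonpos_of_nonneg_of_nonpos (sub_nonneg.2 (hmin s ⟨hs'.1.le, hs'.2.le⟩))
    (by linarith [hs'.2] : s - t ≤ 0)
  linarith

/-- Maximum principle on the strip `[0, T] × ℝ`.  The differential inequality is required only at
the points where `z` is negative, so that no lateral boundary has to be treated separately. -/
theorem nonneg_of_parabolic {z : ℝ → ℝ → ℝ} {T M c : ℝ}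
    (hcont : ContinuousOn (fun q : ℝ × ℝ => z q.1 q.2) (Icc 0 T ×ˢ univ))
    (hbdd : ∀ t ∈ Icc 0 T, ∀ x, -M ≤ z t x)
    (hinit : ∀ x, 0 ≤ z 0 x)
    (hpde : ∀ t ∈ Ioc 0 T, ∀ x, z t x < 0 → ∃ (d : ℝ → ℝ) (zt zxx : ℝ),
      (∀ y, HasDerivAt (z t) (d y) y) ∧ HasDerivAt d zxx x ∧
        HasDerivAt (fun s => z s x) zt t ∧ c * z t x ≤ zt - zxx) :
    ∀ t ∈ Icc 0 T, ∀ x, 0 ≤ z t x := by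
  by_contra! hneg
  obtain ⟨t₁, ht₁, x₁, hz₁⟩ := hneg
  -- The weight `e^{-Λt}` with `Λ > c` absorbs the zeroth-order term `c z`.
  set Λ : ℝ := |c| + 1
  have hΛc : c ≤ Λ := by have := le_abs_self c; simp only [Λ]; linarith
  have hΛ : 0 ≤ Λ := by positivity
  obtain ⟨η, hη, hη₁⟩ : ∃ η > 0, Real.exp (-Λ * t₁) * z t₁ x₁ + η * (x₁ ^ 2 + 4 * t₁) < 0 := by
    have h : Tendsto (fun η : ℝ => Real.exp (-Λ * t₁) * z t₁ x₁ + η * (x₁ ^ 2 + 4 * t₁))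
        (𝓝[>] 0) (𝓝 (Real.exp (-Λ * t₁) * z t₁ x₁ + 0 * (x₁ ^ 2 + 4 * t₁))) :=
      ((by fun_prop : Continuous fun η : ℝ =>
        Real.exp (-Λ * t₁) * z t₁ x₁ + η * (x₁ ^ 2 + 4 * t₁)).tendsto 0).mono_left
        nhdsWithin_le_nhds
    have hlt : Real.exp (-Λ * t₁) * z t₁ x₁ + 0 * (x₁ ^ 2 + 4 * t₁) < 0 := by
      have := mul_neg_of_pos_of_neg (Real.exp_pos (-Λ * t₁)) hz₁
      linarith
    obtain ⟨η, h1, h2⟩ := ((h.eventually (gt_mem_nhds hlt)).and self_mem_nhdsWithin).exists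
    exact ⟨η, h2, h1⟩
  -- The quadratic term makes `w` coercive in `x`, so its minimum over the strip is attained.
  let w : ℝ × ℝ → ℝ := fun q => Real.exp (-Λ * q.1) * z q.1 q.2 + η * (q.2 ^ 2 + 4 * q.1)
  have hwc : ContinuousOn w (Icc 0 T ×ˢ univ) := by
    refine ContinuousOn.add (ContinuousOn.mul ?_ hcont) ?_ <;> fun_prop
  set R : ℝ := |x₁| + |M| / η + 1
  have hR : 1 ≤ R := by
    have : 0 ≤ |x₁| + |M| / η := by positivity
    simp only [R]; linarith
  have hx₁ : x₁ ∈ Icc (-R) R := by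
    have : |x₁| ≤ R := by
      have : 0 ≤ |M| / η := by positivity
      simp only [R]; linarith
    exact abs_le.1 this
  obtain ⟨⟨t₀, x₀⟩, ⟨ht₀, -⟩, hmin⟩ := (isCompact_Icc.prod isCompact_Icc).exists_isMinOn
    (s := Icc 0 T ×ˢ Icc (-R) R) ⟨(t₁, x₁), ht₁, hx₁⟩
    (hwc.mono (prod_mono_right (subset_univ _)))
  replace ht₀ : t₀ ∈ Icc 0 T := ht₀
  have hw₀ : w (t₀, x₀) < 0 := lt_of_le_of_lt (hmin (mk_mem_prod ht₁ hx₁)) hη₁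
  have hglob : ∀ t ∈ Icc 0 T, ∀ x, w (t₀, x₀) ≤ w (t, x) := by
    intro t ht x
    by_cases hx : x ∈ Icc (-R) R
    · exact hmin (mk_mem_prod ht hx)
    · have hxR : R ≤ |x| := by
        by_contra! h
        exact hx (abs_le.1 h.le)
      have h1 : |M| ≤ η * x ^ 2 := by
        have hMR : |M| / η ≤ R := by
          have := abs_nonneg x₁
          simp only [R]; linarith
        have : |M| / η ≤ x ^ 2 := by
          rw [← sq_abs]; nlinarith
        rwa [div_le_iff₀' hη] at this
      have h2 : -|M| ≤ Real.exp (-Λ * t) * z t x := by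
        have he : Real.exp (-Λ * t) ≤ 1 := Real.exp_le_one_iff.2 (by nlinarith [ht.1])
        have hz : -|M| ≤ z t x := (neg_le_neg (le_abs_self M)).trans (hbdd t ht x)
        nlinarith [Real.exp_pos (-Λ * t), abs_nonneg M]
      have h3 : 0 ≤ η * (4 * t) := by have := ht.1; positivity
      have : 0 ≤ w (t, x) := by simp only [w]; linarith
      linarith
  have hz₀ : z t₀ x₀ < 0 := by
    by_contra! h
    have h1 : 0 ≤ Real.exp (-Λ * t₀) * z t₀ x₀ := by positivity
    have h2 : 0 ≤ η * (x₀ ^ 2 + 4 * t₀) := by have := ht₀.1; positivity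
    simp only [w] at hw₀
    linarith
  have ht₀pos : 0 < t₀ := by
    rcases ht₀.1.eq_or_lt with h | h
    · rw [← h] at hz₀; exact absurd (hinit x₀) (not_le.2 hz₀)
    · exact h
  obtain ⟨d, zt, zxx, hd, hdd, hzt, hineq⟩ := hpde t₀ ⟨ht₀pos, ht₀.2⟩ x₀ hz₀
  have hwx : ∀ y, HasDerivAt (fun y => w (t₀, y)) (Real.exp (-Λ * t₀) * d y + η * (2 * y)) y := by
    intro y
    have h := ((hd y).const_mul (Real.exp (-Λ * t₀))).add
      ((((hasDerivAt_id y).pow 2).add_const (4 * t₀)).const_mul η)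
    exact h.congr_deriv (by simp)
  have hwxx : HasDerivAt (fun y => Real.exp (-Λ * t₀) * d y + η * (2 * y))
      (Real.exp (-Λ * t₀) * zxx + η * 2) x₀ := by
    have h := (hdd.const_mul (Real.exp (-Λ * t₀))).add
      (((hasDerivAt_id x₀).const_mul 2).const_mul η)
    exact h.congr_deriv (by simp)
  have hwt : HasDerivAt (fun s => w (s, x₀))
      (Real.exp (-Λ * t₀) * (zt - Λ * z t₀ x₀) + η * 4) t₀ := by
    have h := ((((hasDerivAt_id t₀).const_mul (-Λ)).exp).mul hzt).add
      ((((hasDerivAt_id t₀).const_mul 4).const_add (x₀ ^ 2)).const_mul η)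
    exact h.congr_deriv (by simp only [id]; ring)
  have hxx := second_deriv_nonneg_of_isLocalMin hwx hwxx
    (Filter.Eventually.of_forall fun y => hglob t₀ ht₀ y)
  have ht := deriv_nonpos_of_left_min ht₀pos hwt
    fun s hs => hglob s ⟨hs.1, hs.2.trans ht₀.2⟩ x₀
  have hE := Real.exp_pos (-Λ * t₀)
  have h1 : 0 ≤ zt - zxx - Λ * z t₀ x₀ := by nlinarith
  nlinarith [mul_nonneg hE.le h1]

/-- Comparison for the reaction-diffusion equation with a corrected subsolution `Y - b`: the
correction `b ≥ 0` is a supersolution of the equation linearised with the largest slope `L` of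
`f`, so it may absorb any defect of `Y` as an initial or lateral barrier. -/
theorem solution_ge_sub {f : ℝ → ℝ} {L ε T M : ℝ} {v : ℝ → ℝ} {u : ℝ → ℝ → ℝ}
    (hL : ∀ w₁ w₂, w₁ ≤ w₂ → f w₂ - f w₁ ≤ L * (w₂ - w₁)) (hε : 0 < ε)
    (hu : IsAllenCahnSolution f ε v u) {Y b Yt Yx Yxx bt bx bxx : ℝ → ℝ → ℝ}
    (hYc : ContinuousOn (fun q : ℝ × ℝ => Y q.1 q.2) (Icc 0 T ×ˢ univ))
    (hbc : ContinuousOn (fun q : ℝ × ℝ => b q.1 q.2) (Icc 0 T ×ˢ univ))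
    (hYt : ∀ t ∈ Ioc 0 T, ∀ x, HasDerivAt (fun s => Y s x) (Yt t x) t)
    (hYx : ∀ t ∈ Ioc 0 T, ∀ x, HasDerivAt (Y t) (Yx t x) x)
    (hYxx : ∀ t ∈ Ioc 0 T, ∀ x, HasDerivAt (Yx t) (Yxx t x) x)
    (hbt : ∀ t ∈ Ioc 0 T, ∀ x, HasDerivAt (fun s => b s x) (bt t x) t)
    (hbx : ∀ t ∈ Ioc 0 T, ∀ x, HasDerivAt (b t) (bx t x) x)
    (hbxx : ∀ t ∈ Ioc 0 T, ∀ x, HasDerivAt (bx t) (bxx t x) x)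
    (hb0 : ∀ t ∈ Icc 0 T, ∀ x, 0 ≤ b t x)
    (hYM : ∀ t ∈ Icc 0 T, ∀ x, Y t x ≤ M)
    (hinit : ∀ x, Y 0 x - b 0 x ≤ v x)
    (hb : ∀ t ∈ Ioc 0 T, ∀ x, L / ε * b t x ≤ bt t x - bxx t x)
    (hY : ∀ t ∈ Ioc 0 T, ∀ x, u t x < Y t x - b t x →
      Yt t x - Yxx t x ≤ 1 / ε * f (Y t x)) :
    ∀ t ∈ Icc 0 T, ∀ x, Y t x - b t x ≤ u t x := by
  obtain ⟨B, hB⟩ := hu.bounded T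
  have key := nonneg_of_parabolic (z := fun t x => u t x - Y t x + b t x) (M := B + M)
    (c := L / ε)
    (((hu.continuousOn.mono (prod_mono_left Icc_subset_Ici_self)).sub hYc).add hbc)
    (fun t ht x => by
      have h1 := (abs_le.1 (hB t ht x)).1
      have h2 := hYM t ht x
      have h3 := hb0 t ht x
      linarith)
    (fun x => by
      have := hinit x
      simp only [hu.initial x]; linarith)
    (fun t ht x hz => by
      have h2 := hu.contDiff t ht.1
      have hd : Differentiable ℝ (u t) := h2.differentiable (by norm_num)
      have hdd : Differentiable ℝ (deriv (u t)) := by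
        have : ContDiff ℝ 1 (deriv (u t)) :=
          ((contDiff_succ_iff_deriv (n := 1)).1 (by simpa [one_add_one_eq_two] using h2)).2.2
        exact this.differentiable (by norm_num)
      refine ⟨fun y => deriv (u t) y - Yx t y + bx t y, _, _,
        fun y => ((hd y).hasDerivAt.sub (hYx t ht y)).add (hbx t ht y),
        ((hdd x).hasDerivAt.sub (hYxx t ht x)).add (hbxx t ht x),
        ((hu.equation t ht.1 x).sub (hYt t ht x)).add (hbt t ht x), ?_⟩
      have h3 := hY t ht x (by linarith)
      have h4 := hb t ht x
      have h5 := hb0 t ⟨ht.1.le, ht.2⟩ x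
      have h6 := hL (u t x) (Y t x) (by linarith)
      have h7 : 1 / ε * (f (Y t x) - f (u t x)) ≤ 1 / ε * (L * (Y t x - u t x)) :=
        mul_le_mul_of_nonneg_left h6 (by positivity)
      have h8 : L / ε * (u t x - Y t x + b t x)
          = L / ε * b t x - 1 / ε * (L * (Y t x - u t x)) := by ring
      rw [h8]
      linarith)
  intro t ht x
  have := key t ht x
  linarith

/-! ### Subsolutions of the ordinary differential equation -/

/-- An explicit time function whose inverse is a subsolution of `Y' = f(Y)`: its derivative
dominates `1 / f` on `(a0, ap)`, with the logarithmic singularities produced by the rate `m` at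
`a0` and the rate `r` at `ap`. -/
noncomputable def travelTime (a0 ap m r N v : ℝ) : ℝ :=
  m⁻¹ * Real.log (v - a0) - r⁻¹ * Real.log (ap - v) + N * v

lemma hasDerivAt_travelTime {a0 ap m r N v : ℝ} (hv : v ∈ Ioo a0 ap) :
    HasDerivAt (travelTime a0 ap m r N) (m⁻¹ * (v - a0)⁻¹ + r⁻¹ * (ap - v)⁻¹ + N) v := by
  have h1 : v - a0 ≠ 0 := (sub_pos.2 hv.1).ne'
  have h2 : ap - v ≠ 0 := (sub_pos.2 hv.2).ne'
  have h := ((((hasDerivAt_id v).sub_const a0).log h1).const_mul m⁻¹).sub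
    ((((hasDerivAt_id v).const_sub ap).log h2).const_mul r⁻¹) |>.add
    ((hasDerivAt_id v).const_mul N)
  refine HasDerivAt.congr_deriv h ?_
  simp only [id]
  field_simp
  ring

lemma strictMonoOn_travelTime {a0 ap m r N : ℝ} (hm : 0 < m) (hr : 0 < r) (hN : 0 ≤ N) :
    StrictMonoOn (travelTime a0 ap m r N) (Ioo a0 ap) := by
  intro v hv w hw hvw
  have h1 : Real.log (v - a0) < Real.log (w - a0) :=
    Real.log_lt_log (by linarith [hv.1]) (by linarith)
  have h2 : Real.log (ap - w) < Real.log (ap - v) :=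
    Real.log_lt_log (by linarith [hw.2]) (by linarith)
  have h3 := mul_lt_mul_of_pos_left h1 (inv_pos.2 hm)
  have h4 := mul_lt_mul_of_pos_left h2 (inv_pos.2 hr)
  have h5 := mul_le_mul_of_nonneg_left hvw.le hN
  unfold travelTime
  linarith

lemma surjOn_travelTime {a0 ap m r N : ℝ} (hlt : a0 < ap) (hm : 0 < m) (hr : 0 < r) :
    SurjOn (travelTime a0 ap m r N) (Ioo a0 ap) univ := by
  refine ContinuousOn.surjOn_of_tendsto (nonempty_Ioo.2 hlt)
    (fun v hv => (hasDerivAt_travelTime hv).continuousAt.continuousWithinAt) ?_ ?_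
  · rw [tendsto_comp_coe_Ioo_atBot hlt]
    have h1 : Tendsto (fun v => m⁻¹ * Real.log (v - a0)) (𝓝[>] a0) atBot := by
      refine Tendsto.const_mul_atBot (inv_pos.2 hm) (Real.tendsto_log_nhdsGT_zero.comp ?_)
      refine tendsto_nhdsWithin_iff.2 ⟨?_, ?_⟩
      · have : Tendsto (fun v => v - a0) (𝓝 a0) (𝓝 (a0 - a0)) :=
          (continuous_id.sub continuous_const).tendsto a0
        rw [sub_self] at this
        exact this.mono_left nhdsWithin_le_nhds
      · filter_upwards [self_mem_nhdsWithin] with v hv using sub_pos.2 (by simpa using hv)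
    have h2 : Tendsto (fun v => -(r⁻¹ * Real.log (ap - v)) + N * v) (𝓝[>] a0)
        (𝓝 (-(r⁻¹ * Real.log (ap - a0)) + N * a0)) := by
      have : ContinuousAt (fun v => -(r⁻¹ * Real.log (ap - v)) + N * v) a0 := by
        have : ap - a0 ≠ 0 := (sub_pos.2 hlt).ne'
        fun_prop (disch := assumption)
      exact this.tendsto.mono_left nhdsWithin_le_nhds
    refine (h1.atBot_add h2).congr fun v => ?_
    simp only [travelTime]; ring
  · rw [tendsto_comp_coe_Ioo_atTop hlt]
    have h1 : Tendsto (fun v => r⁻¹ * -Real.log (ap - v)) (𝓝[<] ap) atTop := by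
      refine Tendsto.const_mul_atTop (inv_pos.2 hr)
        (tendsto_neg_atBot_atTop.comp (Real.tendsto_log_nhdsGT_zero.comp ?_))
      refine tendsto_nhdsWithin_iff.2 ⟨?_, ?_⟩
      · have : Tendsto (fun v => ap - v) (𝓝 ap) (𝓝 (ap - ap)) :=
          (continuous_const.sub continuous_id).tendsto ap
        rw [sub_self] at this
        exact this.mono_left nhdsWithin_le_nhds
      · filter_upwards [self_mem_nhdsWithin] with v hv using sub_pos.2 (by simpa using hv)
    have h2 : Tendsto (fun v => m⁻¹ * Real.log (v - a0) + N * v) (𝓝[<] ap)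
        (𝓝 (m⁻¹ * Real.log (ap - a0) + N * ap)) := by
      have : ContinuousAt (fun v => m⁻¹ * Real.log (v - a0) + N * v) ap := by
        have : ap - a0 ≠ 0 := (sub_pos.2 hlt).ne'
        fun_prop (disch := assumption)
      exact this.tendsto.mono_left nhdsWithin_le_nhds
    refine (h1.atTop_add h2).congr fun v => ?_
    simp only [travelTime]; ring

/-- Subsolutions of `Y' = f(Y)` that leave the unstable zero `a0` at rate `m` and reach the stable
zero `ap` at rate `r`, with a bound that is uniform in the starting point. -/
theorem exists_subflow {f : ℝ → ℝ} {a0 ap m r : ℝ} (hlt : a0 < ap) (hm : 0 < m) (hr : 0 < r)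
    (hf : Continuous f) (hpos : ∀ v ∈ Ioo a0 ap, 0 < f v)
    (h0 : ∃ h > 0, ∀ v ∈ Ioo a0 (a0 + h), m * (v - a0) ≤ f v)
    (hp : ∃ h > 0, ∀ v ∈ Ioo (ap - h) ap, r * (ap - v) ≤ f v) :
    ∃ B > 0, ∀ v₀ ∈ Ioo a0 ap, ∃ Y Y' : ℝ → ℝ, Y 0 = v₀ ∧
      (∀ τ, Y τ ∈ Ioo a0 ap ∧ HasDerivAt Y (Y' τ) τ ∧ Y' τ ≤ f (Y τ)) ∧
      ∀ τ, ap - Y τ ≤ B * (v₀ - a0) ^ (-(r / m)) * Real.exp (-(r * τ)) := by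
  obtain ⟨h, hh, h0⟩ := h0
  obtain ⟨k, hk, hp⟩ := hp
  obtain ⟨N, hN, hfN⟩ : ∃ N ≥ 0, ∀ v ∈ Ioo a0 ap,
      (f v)⁻¹ ≤ m⁻¹ * (v - a0)⁻¹ + r⁻¹ * (ap - v)⁻¹ + N := by
    set S := Icc (a0 + h) (ap - k)
    have hS : ∀ v ∈ S, v ∈ Ioo a0 ap := fun v hv => ⟨by linarith [hv.1], by linarith [hv.2]⟩
    obtain ⟨N, hN⟩ := (isCompact_Icc (a := a0 + h) (b := ap - k)).bddAbove_image
      (f := fun v => (f v)⁻¹) (hf.continuousOn.inv₀ fun v hv => (hpos v (hS v hv)).ne')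
    refine ⟨max N 0, le_max_right _ _, fun v hv => ?_⟩
    have hva : 0 < v - a0 := sub_pos.2 hv.1
    have hvp : 0 < ap - v := sub_pos.2 hv.2
    have h1 : 0 ≤ m⁻¹ * (v - a0)⁻¹ := by positivity
    have h2 : 0 ≤ r⁻¹ * (ap - v)⁻¹ := by positivity
    have h3 : 0 ≤ max N 0 := le_max_right _ _
    rcases lt_or_ge v (a0 + h) with hv1 | hv1
    · have := inv_anti₀ (by positivity) (h0 v ⟨hv.1, hv1⟩)
      rw [mul_inv] at this
      linarith
    rcases lt_or_ge (ap - k) v with hv2 | hv2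
    · have := inv_anti₀ (by positivity) (hp v ⟨hv2, hv.2⟩)
      rw [mul_inv] at this
      linarith
    · have := hN (mem_image_of_mem (fun v => (f v)⁻¹) (show v ∈ Icc _ _ from ⟨hv1, hv2⟩))
      linarith [le_max_left N 0]
  set Θ := travelTime a0 ap m r N with hΘ
  have hmono : StrictMonoOn Θ (Ioo a0 ap) := strictMonoOn_travelTime hm hr hN
  choose! V hV hΘV using fun s : ℝ => surjOn_travelTime (N := N) hlt hm hr (mem_univ s)
  have hVmono : StrictMono V := by
    intro s t hst
    rw [← hmono.lt_iff_lt (hV s) (hV t)]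
    rwa [hΘ, hΘV, hΘV]
  have hVimage : V '' univ = Ioo a0 ap := by
    refine Subset.antisymm ?_ fun v hv => ⟨Θ v, mem_univ _, ?_⟩
    · rintro _ ⟨s, -, rfl⟩
      exact hV s
    · exact hmono.injOn (hV _) hv (hΘV _)
  have hVc : ∀ s, ContinuousAt V s := fun s =>
    (hVmono.strictMonoOn univ).continuousAt_of_image_mem_nhds univ_mem
      (by rw [hVimage]; exact isOpen_Ioo.mem_nhds (hV s))
  have hΘ'pos : ∀ v ∈ Ioo a0 ap, 0 < m⁻¹ * (v - a0)⁻¹ + r⁻¹ * (ap - v)⁻¹ + N := by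
    intro v hv
    have hva : 0 < v - a0 := sub_pos.2 hv.1
    have hvp : 0 < ap - v := sub_pos.2 hv.2
    positivity
  have hV' : ∀ s, HasDerivAt V (m⁻¹ * (V s - a0)⁻¹ + r⁻¹ * (ap - V s)⁻¹ + N)⁻¹ s := fun s =>
    HasDerivAt.of_local_left_inverse (hVc s) (hasDerivAt_travelTime (hV s))
      (hΘ'pos _ (hV s)).ne' (Eventually.of_forall hΘV)
  set d := ap - a0
  have hd : 0 < d := sub_pos.2 hlt
  refine ⟨Real.exp (r * (m⁻¹ * Real.log d + N * d) + Real.log d), Real.exp_pos _,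
    fun v₀ hv₀ => ⟨fun τ => V (Θ v₀ + τ), fun τ =>
      (m⁻¹ * (V (Θ v₀ + τ) - a0)⁻¹ + r⁻¹ * (ap - V (Θ v₀ + τ))⁻¹ + N)⁻¹, ?_, ?_, ?_⟩⟩
  · exact hmono.injOn (hV _) hv₀ (by rw [hΘ, hΘV]; simp)
  · refine fun τ => ⟨hV _, HasDerivAt.comp_const_add _ _ (hV' _), ?_⟩
    exact inv_le_of_inv_le₀ (hpos _ (hV _)) (hfN _ (hV _))
  · intro τ
    have hτ := hΘV (Θ v₀ + τ)
    have hv := hV (Θ v₀ + τ)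
    set v := V (Θ v₀ + τ)
    have hva : 0 < v - a0 := sub_pos.2 hv.1
    have hvp : 0 < ap - v := sub_pos.2 hv.2
    have hv₀a : 0 < v₀ - a0 := sub_pos.2 hv₀.1
    have hv₀p : 0 < ap - v₀ := sub_pos.2 hv₀.2
    have h1 : Real.log (v - a0) ≤ Real.log d :=
      Real.log_le_log hva (by simp only [d]; linarith [hv.2])
    have h2 : Real.log (ap - v₀) ≤ Real.log d :=
      Real.log_le_log hv₀p (by simp only [d]; linarith [hv₀.1])
    have h3 : N * (v - v₀) ≤ N * d :=
      mul_le_mul_of_nonneg_left (by simp only [d]; linarith [hv₀.1, hv.2]) hN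
    have h4 := mul_le_mul_of_nonneg_left h1 (inv_pos.2 hm).le
    rw [Real.rpow_def_of_pos hv₀a, ← Real.exp_add, ← Real.exp_add,
      ← Real.log_le_iff_le_exp hvp]
    simp only [hΘ, travelTime] at hτ
    have h5 : Real.log (ap - v) = r * (m⁻¹ * Real.log (v - a0) + N * (v - v₀)
        - m⁻¹ * Real.log (v₀ - a0) - τ) + Real.log (ap - v₀) := by
      have : r * (r⁻¹ * Real.log (ap - v)) = Real.log (ap - v) := by field_simp
      have h' : r * (r⁻¹ * Real.log (ap - v₀)) = Real.log (ap - v₀) := by field_simp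
      rw [← this, ← h']
      linear_combination (-r) * hτ
    have h6 : r * (m⁻¹ * Real.log (v - a0) + N * (v - v₀))
        ≤ r * (m⁻¹ * Real.log d + N * d) := mul_le_mul_of_nonneg_left (by linarith) hr.le
    rw [h5]
    have h7 : Real.log (v₀ - a0) * -(r / m) = -(r * (m⁻¹ * Real.log (v₀ - a0))) := by
      field_simp
    rw [h7]
    linarith

/-! ### Lower barriers -/

/-- The one-sided part of the bistability assumption that is needed for lower bounds on solutions;
`L` bounds all difference quotients of `f` from above.  For a bistable `f`, both `f` and its
reflection `v ↦ -f (-v)` have this property. -/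
structure LowerReaction (f : ℝ → ℝ) (am a0 ap p μ L : ℝ) : Prop where
  continuous : Continuous f
  lt_left : am < a0
  lt_right : a0 < ap
  p_pos : 0 < p
  mu_pos : 0 < μ
  slope_le : ∀ w₁ w₂, w₁ ≤ w₂ → f w₂ - f w₁ ≤ L * (w₂ - w₁)
  pos : ∀ v ∈ Ioo a0 ap, 0 < f v
  zero_a0 : f a0 = 0
  zero_ap : f ap = 0
  deriv_a0 : HasDerivAt f μ a0
  deriv_ap : HasDerivAt f (-p) ap
  ge_of_le : ∀ v ≤ am, -p * (v - am) ≤ f v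

/-- The part of the assumptions on the initial value that is needed for lower bounds; `k` is the
rate of convergence to the stable states at `±∞`. -/
structure LowerInitial (am ap k C0 ε : ℝ) (v : ℝ → ℝ) : Prop where
  abs_le : ∀ x, |v x| ≤ C0
  lipschitz : ∀ x y, |v x - v y| ≤ C0 * |x - y|
  right : ∀ x, 1 ≤ x → ap - ε * Real.exp (-(k * x)) ≤ v x
  left : ∀ x, x ≤ -1 → am - ε * Real.exp (k * x) ≤ v x

lemma LowerReaction.exists_rate_a0 {f : ℝ → ℝ} {am a0 ap p μ L m : ℝ}
    (hf : LowerReaction f am a0 ap p μ L) (hm : m < μ) :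
    ∃ h > 0, ∀ v ∈ Ioo a0 (a0 + h), m * (v - a0) ≤ f v := by
  have h1 : ∀ᶠ v in 𝓝[>] a0, m < slope f a0 v :=
    (hf.deriv_a0.tendsto_slope.mono_left
      (nhdsWithin_mono _ fun s hs => ne_of_gt hs)).eventually (lt_mem_nhds hm)
  obtain ⟨b, hb, hb'⟩ := mem_nhdsGT_iff_exists_Ioo_subset.1 h1
  refine ⟨b - a0, sub_pos.2 hb, fun v hv => ?_⟩
  have h2 : m < slope f a0 v := hb' ⟨hv.1, by linarith [hv.2]⟩
  rw [slope_def_field, hf.zero_a0, sub_zero, lt_div_iff₀ (sub_pos.2 hv.1)] at h2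
  exact h2.le

lemma LowerReaction.exists_rate_ap {f : ℝ → ℝ} {am a0 ap p μ L r : ℝ}
    (hf : LowerReaction f am a0 ap p μ L) (hr : r < p) :
    ∃ h > 0, ∀ v ∈ Ioo (ap - h) ap, r * (ap - v) ≤ f v := by
  have h1 : ∀ᶠ v in 𝓝[<] ap, slope f ap v < -r :=
    (hf.deriv_ap.tendsto_slope.mono_left
      (nhdsWithin_mono _ fun s hs => ne_of_lt hs)).eventually (gt_mem_nhds (neg_lt_neg hr))
  obtain ⟨b, hb, hb'⟩ := mem_nhdsLT_iff_exists_Ioo_subset.1 h1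
  refine ⟨ap - b, sub_pos.2 hb, fun v hv => ?_⟩
  have h2 : slope f ap v < -r := hb' ⟨by linarith [hv.1], hv.2⟩
  rw [slope_def_field, hf.zero_ap, sub_zero, div_lt_iff_of_neg (sub_neg.2 hv.2)] at h2
  linarith

section barriers

variable {f : ℝ → ℝ} {am a0 ap p μ L ε : ℝ} {v : ℝ → ℝ} {u : ℝ → ℝ → ℝ}

lemma hasDerivAt_exp_time (A B C t : ℝ) :
    HasDerivAt (fun s => A * Real.exp (B + C * s)) (C * (A * Real.exp (B + C * t))) t := by
  have h := (((((hasDerivAt_id t).const_mul C).const_add B).exp).const_mul A)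
  refine HasDerivAt.congr_deriv h ?_
  simp only [id]; ring

lemma hasDerivAt_exp_space (A k D x : ℝ) :
    HasDerivAt (fun y => A * Real.exp (k * y + D)) (k * (A * Real.exp (k * x + D))) x := by
  have h := (((((hasDerivAt_id x).const_mul k).add_const D).exp).const_mul A)
  refine HasDerivAt.congr_deriv h ?_
  simp only [id]; ring

/-- Below `am` the reaction is at least linear with rate `p`, so exponential profiles below `am`
are subsolutions. -/
theorem solution_ge_exp (hf : LowerReaction f am a0 ap p μ L) (hε : 0 < ε)
    (hu : IsAllenCahnSolution f ε v u) {A k : ℝ} (hA : 0 ≤ A)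
    (hv : ∀ x, am - A * Real.exp (k * x) ≤ v x) {t : ℝ} (ht : 0 ≤ t) (x : ℝ) :
    am - A * Real.exp (k * x + (k ^ 2 - p / ε) * t) ≤ u t x := by
  set C := k ^ 2 - p / ε with hC
  have key := solution_ge_sub hf.slope_le hε hu (T := t) (M := am)
    (Y := fun t x => am - A * Real.exp (k * x + C * t)) (b := fun _ _ => 0)
    (Yt := fun t x => -(C * (A * Real.exp (k * x + C * t))))
    (Yx := fun t x => -(k * (A * Real.exp (k * x + C * t))))
    (Yxx := fun t x => -(k * (k * (A * Real.exp (k * x + C * t)))))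
    (bt := fun _ _ => 0) (bx := fun _ _ => 0) (bxx := fun _ _ => 0)
    (by fun_prop) (by fun_prop)
    (fun t _ x => (hasDerivAt_exp_time _ _ _ _).const_sub am)
    (fun t _ x => (hasDerivAt_exp_space _ _ _ _).const_sub am)
    (fun t _ x => ((hasDerivAt_exp_space _ _ _ _).const_mul k).neg)
    (fun t _ x => hasDerivAt_const _ _) (fun t _ x => hasDerivAt_const _ _)
    (fun t _ x => hasDerivAt_const _ _) (fun _ _ _ => le_rfl)
    (fun s _ y => by
      have : 0 ≤ A * Real.exp (k * y + C * s) := by positivity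
      linarith)
    (fun x => by simpa using hv x) (fun _ _ _ => by simp)
    (fun s _ y _ => by
      have h0 : 0 ≤ A * Real.exp (k * y + C * s) := by positivity
      have h1 := hf.ge_of_le (am - A * Real.exp (k * y + C * s)) (by linarith)
      have h2 := mul_le_mul_of_nonneg_left h1 (one_div_pos.2 hε).le
      refine le_trans (le_of_eq ?_) h2
      rw [hC]; ring)
  simpa using key t ⟨ht, le_rfl⟩ x

/-- A solution above `Y 0` on an interval of radius `R` stays, at the centre, above the spatially
constant subsolution `Y` up to an error that is small once `R` exceeds the diffusion length. -/
theorem solution_ge_local (hf : LowerReaction f am a0 ap p μ L) (hε : 0 < ε)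
    (hu : IsAllenCahnSolution f ε v u) {Y Y' : ℝ → ℝ} {x₀ R M a : ℝ}
    (ha2 : a ^ 2 = 1 / ε) (hR : 0 ≤ R) (hM : 0 ≤ M)
    (hY : ∀ τ, Y τ ≤ ap ∧ HasDerivAt Y (Y' τ) τ ∧ Y' τ ≤ f (Y τ))
    (hYv : ∀ x, |x - x₀| ≤ R → Y 0 ≤ v x) (hvM : ∀ x, ap - M ≤ v x)
    {t : ℝ} (ht : 0 ≤ t) :
    Y (t / ε) - M / Real.cosh (a * R) * Real.exp ((L + 1) / ε * t) ≤ u t x₀ := by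
  have hYc : Continuous Y := continuous_iff_continuousAt.2 fun τ => (hY τ).2.1.continuousAt
  set C := (L + 1) / ε with hC
  -- The barrier `D e^{Cs} cosh(a (y - x₀))` is at least `M` at distance `R` from `x₀`.
  set D := M / Real.cosh (a * R) with hD
  have hD0 : 0 ≤ D := div_nonneg hM (Real.cosh_pos _).le
  have hbx : ∀ s y, HasDerivAt (fun y => D * Real.exp (C * s) * Real.cosh (a * (y - x₀)))
      (D * Real.exp (C * s) * (a * Real.sinh (a * (y - x₀)))) y := by
    intro s y
    have h := ((((hasDerivAt_id y).sub_const x₀).const_mul a).cosh).const_mul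
      (D * Real.exp (C * s))
    refine HasDerivAt.congr_deriv h ?_
    simp only [id]; ring
  have hbxx : ∀ s y, HasDerivAt
      (fun y => D * Real.exp (C * s) * (a * Real.sinh (a * (y - x₀))))
      (a ^ 2 * (D * Real.exp (C * s) * Real.cosh (a * (y - x₀)))) y := by
    intro s y
    have h := (((((hasDerivAt_id y).sub_const x₀).const_mul a).sinh).const_mul a).const_mul
      (D * Real.exp (C * s))
    refine HasDerivAt.congr_deriv h ?_
    simp only [id]; ring
  have hbt : ∀ s y, HasDerivAt (fun s => D * Real.exp (C * s) * Real.cosh (a * (y - x₀)))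
      (C * (D * Real.exp (C * s) * Real.cosh (a * (y - x₀)))) s := by
    intro s y
    have h := ((((hasDerivAt_id s).const_mul C).exp).const_mul D).mul_const
      (Real.cosh (a * (y - x₀)))
    refine HasDerivAt.congr_deriv h ?_
    simp only [id]; ring
  have hb0 : ∀ s y, 0 ≤ D * Real.exp (C * s) * Real.cosh (a * (y - x₀)) := fun s y =>
    mul_nonneg (mul_nonneg hD0 (Real.exp_pos _).le) (Real.cosh_pos _).le
  have key := solution_ge_sub hf.slope_le hε hu (T := t) (M := ap)
    (Y := fun s _ => Y (s / ε))
    (b := fun s y => D * Real.exp (C * s) * Real.cosh (a * (y - x₀)))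
    (Yt := fun s _ => Y' (s / ε) * (1 / ε)) (Yx := fun _ _ => 0) (Yxx := fun _ _ => 0)
    (by fun_prop) (by fun_prop)
    (fun s _ y => ((hY (s / ε)).2.1).comp s ((hasDerivAt_id s).div_const ε))
    (fun _ _ _ => hasDerivAt_const _ _) (fun _ _ _ => hasDerivAt_const _ _)
    (fun s _ y => hbt s y) (fun s _ y => hbx s y) (fun s _ y => hbxx s y)
    (fun s _ y => hb0 s y) (fun s _ _ => (hY _).1)
    (fun x => by
      have h0 := hb0 0 x
      simp only [zero_div]
      by_cases hx : |x - x₀| ≤ R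
      · linarith [hYv x hx]
      · have h1 : Real.cosh (a * R) ≤ Real.cosh (a * (x - x₀)) := by
          rw [Real.cosh_le_cosh, abs_mul, abs_mul, abs_of_nonneg hR]
          exact mul_le_mul_of_nonneg_left (not_le.1 hx).le (abs_nonneg a)
        have h2 : M ≤ D * Real.cosh (a * (x - x₀)) := by
          calc M = D * Real.cosh (a * R) := by
                rw [hD, div_mul_cancel₀ _ (Real.cosh_pos _).ne']
            _ ≤ _ := mul_le_mul_of_nonneg_left h1 hD0
        have h3 := (hY 0).1
        have h4 := hvM x
        simp only [mul_zero, Real.exp_zero, mul_one]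
        linarith)
    (fun s _ y => by
      rw [ha2, hC]
      refine le_of_eq ?_
      ring)
    (fun s _ y _ => by
      have := mul_le_mul_of_nonneg_left (hY (s / ε)).2.2 (one_div_pos.2 hε).le
      linarith)
  have := key t ⟨ht, le_rfl⟩ x₀
  simpa using this

/-- Near `+∞` the solution relaxes to `ap` exponentially, uniformly with the weight `e^{-kx}`.
The second barrier accounts for the unknown values to the left of `x = 1`. -/
theorem solution_ge_right (hf : LowerReaction f am a0 ap p μ L) (hε : 0 < ε)
    (hu : IsAllenCahnSolution f ε v u) {h k r M a : ℝ} (ha : 0 ≤ a)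
    (ha2 : a ^ 2 = 1 / ε) (hh : 0 ≤ h) (hk : 0 ≤ k) (hL : 0 ≤ L)
    (hr : ∀ s ∈ Icc 0 h, r * s ≤ f (ap - s)) (hkr : k ^ 2 ≤ r / ε)
    (hv : ∀ x, 1 ≤ x → ap - h * Real.exp (-k * x + k) ≤ v x) {t : ℝ} (ht : 0 ≤ t)
    (hM : ∀ s ∈ Icc 0 t, ∀ x, ap - M ≤ u s x) (hM0 : 0 ≤ M) (x : ℝ) :
    ap - h * Real.exp (-k * x + (k + (k ^ 2 - r / ε) * t))
      - M * Real.exp (-a * x + (a + (L + 1) / ε * t)) ≤ u t x := by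
  set C := k ^ 2 - r / ε with hC
  set E := (L + 1) / ε with hE
  have hE0 : 0 ≤ E := by positivity
  have hleft : ∀ s, 0 ≤ s → ∀ y ≤ 1, M ≤ M * Real.exp (-a * y + (a + E * s)) := by
    intro s hs y hy
    refine le_mul_of_one_le_right hM0 (Real.one_le_exp ?_)
    have h1 : 0 ≤ E * s := by positivity
    nlinarith
  have key := solution_ge_sub hf.slope_le hε hu (T := t) (M := ap)
    (Y := fun s y => ap - h * Real.exp (-k * y + (k + C * s)))
    (b := fun s y => M * Real.exp (-a * y + (a + E * s)))
    (Yt := fun s y => -(C * (h * Real.exp (-k * y + (k + C * s)))))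
    (Yx := fun s y => -(-k * (h * Real.exp (-k * y + (k + C * s)))))
    (Yxx := fun s y => -(-k * (-k * (h * Real.exp (-k * y + (k + C * s))))))
    (bt := fun s y => E * (M * Real.exp (-a * y + (a + E * s))))
    (bx := fun s y => -a * (M * Real.exp (-a * y + (a + E * s))))
    (bxx := fun s y => -a * (-a * (M * Real.exp (-a * y + (a + E * s)))))
    (by fun_prop) (by fun_prop)
    (fun s _ y => by
      simp only [← add_assoc]
      exact (hasDerivAt_exp_time _ _ _ _).const_sub ap)
    (fun s _ y => (hasDerivAt_exp_space _ _ _ _).const_sub ap)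
    (fun s _ y => ((hasDerivAt_exp_space _ _ _ _).const_mul (-k)).neg)
    (fun s _ y => by
      simp only [← add_assoc]
      exact hasDerivAt_exp_time _ _ _ _)
    (fun s _ y => hasDerivAt_exp_space _ _ _ _)
    (fun s _ y => (hasDerivAt_exp_space _ _ _ _).const_mul (-a))
    (fun s _ y => by positivity)
    (fun s _ y => by
      have : 0 ≤ h * Real.exp (-k * y + (k + C * s)) := by positivity
      linarith)
    (fun y => by
      simp only [mul_zero, add_zero]
      have h0 : 0 ≤ h * Real.exp (-k * y + k) := by positivity
      have h1 : 0 ≤ M * Real.exp (-a * y + a) := by positivity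
      rcases le_total 1 y with hy | hy
      · linarith [hv y hy]
      · have h2 := hleft 0 le_rfl y hy
        have h3 := hM 0 ⟨le_rfl, ht⟩ y
        rw [hu.initial] at h3
        simp only [mul_zero, add_zero] at h2
        linarith)
    (fun s _ y => by
      have h1 : L / ε = E - a ^ 2 := by rw [ha2, hE]; ring
      rw [h1]
      refine le_of_eq ?_
      ring)
    (fun s hs y hy => by
      have h0 : 0 ≤ h * Real.exp (-k * y + (k + C * s)) := by positivity
      rcases le_total y 1 with hy1 | hy1
      · have h2 := hleft s hs.1.le y hy1
        have h3 := hM s ⟨hs.1.le, hs.2⟩ y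
        linarith
      · have h1 : h * Real.exp (-k * y + (k + C * s)) ≤ h := by
          refine mul_le_of_le_one_right hh (Real.exp_le_one_iff.2 ?_)
          have : C * s ≤ 0 := mul_nonpos_of_nonpos_of_nonneg (by rw [hC]; linarith) hs.1.le
          nlinarith
        have h2 := mul_le_mul_of_nonneg_left (hr _ ⟨h0, h1⟩) (one_div_pos.2 hε).le
        refine le_trans (le_of_eq ?_) h2
        rw [hC]; ring)
  exact key t ⟨ht, le_rfl⟩ x

end barriers

/-! ### Asymptotics as `ε → 0` -/

lemma eventually_mul_rpow_le (A : ℝ) {s κ η : ℝ} (hs : κ < s) (hη : 0 < η) :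
    ∀ᶠ ε : ℝ in 𝓝[>] 0, A * ε ^ s ≤ η * ε ^ κ := by
  have h1 : Tendsto (fun ε : ℝ => A * ε ^ (s - κ)) (𝓝[>] 0) (𝓝 (A * 0 ^ (s - κ))) :=
    ((Real.continuousAt_rpow_const 0 (s - κ) (Or.inr (sub_pos.2 hs).le)).tendsto.const_mul
      A).mono_left nhdsWithin_le_nhds
  rw [Real.zero_rpow (sub_pos.2 hs).ne', mul_zero] at h1
  filter_upwards [h1.eventually (gt_mem_nhds hη), self_mem_nhdsWithin] with ε h2 hε
  have hε : 0 < ε := hε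
  have h3 : ε ^ s = ε ^ (s - κ) * ε ^ κ := by rw [← Real.rpow_add hε]; ring_nf
  rw [h3, ← mul_assoc]
  exact mul_le_mul_of_nonneg_right h2.le (by positivity)

lemma eventually_rpow_mul_exp_le (A s κ : ℝ) {q r η : ℝ} (hq : 0 < q) (hr : 0 < r)
    (hη : 0 < η) :
    ∀ᶠ ε : ℝ in 𝓝[>] 0, A * ε ^ (-s) * Real.exp (-(r * ε ^ (-q))) ≤ η * ε ^ κ := by
  have h1 := ((tendsto_rpow_mul_exp_neg_mul_atTop_nhds_zero ((s + κ) / q) r hr).comp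
    (tendsto_rpow_neg_nhdsGT_zero (neg_neg_of_pos hq))).const_mul A
  rw [mul_zero] at h1
  filter_upwards [h1.eventually (gt_mem_nhds hη), self_mem_nhdsWithin] with ε h2 hε
  have hε : 0 < ε := hε
  simp only [Function.comp_apply] at h2
  rw [← Real.rpow_mul hε.le, neg_mul, mul_div_cancel₀ _ hq.ne'] at h2
  have h3 : ε ^ (-s) = ε ^ (-(s + κ)) * ε ^ κ := by rw [← Real.rpow_add hε]; ring_nf
  calc A * ε ^ (-s) * Real.exp (-(r * ε ^ (-q)))
      = A * (ε ^ (-(s + κ)) * Real.exp (-r * ε ^ (-q))) * ε ^ κ := by rw [h3, neg_mul]; ring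
    _ ≤ η * ε ^ κ := mul_le_mul_of_nonneg_right h2.le (by positivity)

lemma rpow_neg_half_sq {ε : ℝ} (hε : 0 < ε) : (ε ^ (-(1 / 2) : ℝ)) ^ 2 = 1 / ε := by
  rw [← Real.rpow_natCast, ← Real.rpow_mul hε.le]
  norm_num
  rw [Real.rpow_neg_one]

lemma exp_mul_abs_log {ε : ℝ} (hε : 0 < ε) (hε1 : ε < 1) (c C1 : ℝ) :
    Real.exp (c * (C1 * |Real.log ε|)) = ε ^ (-(c * C1)) := by
  rw [abs_of_neg (Real.log_neg hε hε1), Real.rpow_def_of_pos hε]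
  ring_nf

/-- Lower bounds for the solution at the time `C1 ε |log ε|`.  The lower bound for `C1` leaves
enough time for the flow to climb from `a0 + ε ^ β` to `ap - ε ^ κ`: the first phase takes at most
`(2 β / μ) |log ε|` units of fast time and the second one `(κ / r) |log ε|`. -/
theorem eventually_lower_bounds {f : ℝ → ℝ} {am a0 ap p μ L κ r k C0 : ℝ}
    (hf : LowerReaction f am a0 ap p μ L) (hL : 0 ≤ L) (hκ : 0 < κ) (hκr : κ * μ < r)
    (hr : r < p) (hk : 0 ≤ k) (hkμ : k ^ 2 ≤ μ) (hC0 : 0 < C0) :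
    ∃ Ct > 0, ∀ C1 ∈ Ioo ((2 / μ + κ / r) / 3) (1 / μ), ∀ β ∈ Ioo 0 (1 - C1 * μ),
      ∀ (v : ℝ → ℝ → ℝ) (u : ℝ → ℝ → ℝ → ℝ),
      (∀ᶠ ε in 𝓝[>] 0, LowerInitial am ap k C0 ε (v ε) ∧ IsAllenCahnSolution f ε (v ε) (u ε)) →
      ∀ᶠ ε in 𝓝[>] 0,
        (∀ x, am - ε ^ κ ≤ u ε (C1 * ε * |Real.log ε|) x) ∧
        (∀ x, a0 + 2 * ε ^ β ≤ v ε x → ap - ε ^ κ ≤ u ε (C1 * ε * |Real.log ε|) x) ∧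
        (∀ x, 2 ≤ x → ap - Ct * ε ^ κ * Real.exp (-(k * x)) ≤ u ε (C1 * ε * |Real.log ε|) x) ∧
        (∀ x, am - Ct * ε ^ κ * Real.exp (k * x) ≤ u ε (C1 * ε * |Real.log ε|) x) := by
  have hμ := hf.mu_pos
  have hr0 : 0 < r := lt_trans (by positivity) hκr
  obtain ⟨B, hB, hflow⟩ := exists_subflow hf.lt_right (half_pos hμ) hr0 hf.continuous hf.pos
    (hf.exists_rate_a0 (half_lt_self hμ)) (hf.exists_rate_ap hr)
  obtain ⟨h₁, hh₁, hrate⟩ := hf.exists_rate_ap hr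
  set h := min (h₁ / 2) 1
  have hh : 0 < h := by positivity
  have hh1 : h ≤ 1 := min_le_right _ _
  have hhrate : ∀ s ∈ Icc 0 h, r * s ≤ f (ap - s) := by
    intro s hs
    rcases hs.1.eq_or_lt with h0 | h0
    · rw [← h0]; simp [hf.zero_ap]
    · have h2 : s ≤ h₁ / 2 := hs.2.trans (min_le_left _ _)
      have := hrate (ap - s) ⟨by linarith, by linarith⟩
      simpa using this
  set A₀ := C0 + |am| with hA₀
  have hA₀0 : 0 ≤ A₀ := by positivity
  set A₁ := (A₀ + 1) * Real.exp k with hA₁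
  set M := ap - am + A₀ + |ap|
  have hM0 : 0 ≤ M := by
    have := hf.lt_left.trans hf.lt_right
    have := abs_nonneg ap
    linarith
  refine ⟨A₁ * Real.exp 1 + Real.exp (k + 1) + 1, by positivity, ?_⟩
  intro C1 hC1 β hβ v u hvu
  -- The conditions on `C1` and `β` enter only through the next inequalities between exponents.
  have hC1κ : κ < r * C1 := by
    have h1 : κ / r < 1 / μ := by rw [div_lt_div_iff₀ hr0 hμ]; linarith
    have h2 : κ / r < C1 := by
      have := hC1.1
      have h3 : 2 / μ = 2 * (1 / μ) := by ring
      linarith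
    rwa [div_lt_iff₀' hr0] at h2
  have hC10 : 0 < C1 := by
    by_contra! hneg
    linarith [mul_nonpos_of_nonneg_of_nonpos hr0.le hneg]
  have hC1p : κ < p * C1 := hC1κ.trans (mul_lt_mul_of_pos_right hr hC10)
  have hC1μ : C1 * μ < 1 := (lt_div_iff₀ hμ).1 hC1.2
  have hC1μ' : 1 / 2 < C1 * μ := by
    have h1 : 2 / μ / 3 < C1 := by
      have : 0 < κ / r := by positivity
      linarith [hC1.1]
    rw [div_div, div_lt_iff₀ (by positivity)] at h1
    linarith
  -- Thus `ε ^ β`, the scale of the initial interval, exceeds the diffusion length `ε ^ (1 / 2)`.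
  have hβ2 : 0 < 1 / 2 - β := by linarith [hβ.2]
  -- `f` is used with the rate `μ / 2` instead of `μ` at `a0`, hence the exponent `r / (μ / 2)`.
  have hclimb : κ < r * C1 - β * (r / (μ / 2)) := by
    have h1 : (2 / μ + κ / r) < 3 * C1 := by linarith [hC1.1]
    have h2 : β * (2 / μ) < 2 / μ - 2 * C1 := by
      have := mul_lt_mul_of_pos_right hβ.2 (show 0 < 2 / μ by positivity)
      have h3 : (1 - C1 * μ) * (2 / μ) = 2 / μ - 2 * C1 := by field_simp
      linarith
    have h4 : κ / r < C1 - β * (2 / μ) := by linarith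
    rw [div_lt_iff₀' hr0] at h4
    calc κ < r * (C1 - β * (2 / μ)) := h4
      _ = _ := by field_simp
  have hsmall : ∀ δ : ℝ, 0 < δ → ∀ᶠ ε : ℝ in 𝓝[>] 0, ε < δ := fun δ hδ =>
    (eventually_lt_nhds hδ).filter_mono nhdsWithin_le_nhds
  have hε4k : ∀ᶠ ε : ℝ in 𝓝[>] 0, 4 * k ≤ ε ^ (-(1 / 2) : ℝ) :=
    (tendsto_rpow_neg_nhdsGT_zero (by norm_num : (-(1 / 2) : ℝ) < 0)).eventually_ge_atTop _
  filter_upwards [hvu, self_mem_nhdsWithin, hsmall 1 one_pos, hsmall h hh,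
    hsmall (r / (k ^ 2 + 1)) (by positivity), hε4k,
    eventually_mul_rpow_le A₀ hC1p one_pos,
    eventually_mul_rpow_le 1 hβ.1 (half_pos (sub_pos.2 hf.lt_right)),
    eventually_mul_rpow_le B hclimb (half_pos one_pos),
    eventually_rpow_mul_exp_le (2 * M) ((L + 1) * C1) κ hβ2 (inv_pos.2 hC0) (half_pos one_pos),
    eventually_rpow_mul_exp_le M ((L + 1) * C1) κ (half_pos one_pos) (half_pos one_pos) one_pos]
    with ε ⟨hv, hu⟩ hε hε1 hεh hεr hεk hA hεβ hεB hεM hεM'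
  replace hε : 0 < ε := hε
  rw [Real.rpow_zero, one_mul, mul_one] at hεβ
  rw [one_mul] at hA hεM'
  set Λ := |Real.log ε|
  set t := C1 * ε * Λ with ht
  have ht0 : 0 ≤ t := by positivity
  have htε : t / ε = C1 * Λ := by rw [ht]; field_simp
  have hscale : ∀ c, Real.exp (c / ε * t) = ε ^ (-(c * C1)) := fun c => by
    rw [← exp_mul_abs_log hε hε1, div_mul_eq_mul_div, mul_div_assoc, htε]
  have hkt : k ^ 2 * t ≤ 1 := by
    have h1 : ε * Λ ≤ 1 := by
      have := Real.abs_log_mul_self_lt ε hε hε1.le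
      rw [abs_mul, abs_of_pos hε] at this
      linarith
    have h2 : 0 ≤ ε * Λ := by positivity
    have h3 : k ^ 2 * C1 ≤ 1 := by linarith [mul_le_mul_of_nonneg_right hkμ hC10.le]
    calc k ^ 2 * t = (k ^ 2 * C1) * (ε * Λ) := by rw [ht]; ring
      _ ≤ 1 := mul_le_one₀ h3 h2 h1
  have hdecay : ∀ c, κ ≤ c * C1 → Real.exp ((k ^ 2 - c / ε) * t) ≤ Real.exp 1 * ε ^ κ := by
    intro c hc
    have h1 : (k ^ 2 - c / ε) * t = k ^ 2 * t + (-c) / ε * t := by ring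
    rw [h1, Real.exp_add, hscale]
    refine mul_le_mul (Real.exp_le_exp.2 hkt) ?_ (by positivity) (by positivity)
    exact Real.rpow_le_rpow_of_exponent_ge hε hε1.le (by linarith)
  -- The constant profile is the case `k = 0` of the exponential one.
  have hexp_am : ∀ x, am - A₀ * Real.exp (0 * x) ≤ v ε x := fun x => by
    have h1 := (abs_le.1 (hv.abs_le x)).1
    have h2 := le_abs_self am
    simp only [zero_mul, Real.exp_zero, mul_one]
    linarith
  have hall : ∀ s, 0 ≤ s → ∀ x, am - A₀ ≤ u ε s x := by
    intro s hs x
    refine le_trans ?_ (solution_ge_exp hf hε hu hA₀0 hexp_am hs x)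
    have h1 : Real.exp (0 * x + (0 ^ 2 - p / ε) * s) ≤ 1 := by
      have := hf.p_pos
      have : 0 ≤ p / ε * s := by positivity
      exact Real.exp_le_one_iff.2 (by linarith)
    linarith [mul_le_of_le_one_right hA₀0 h1]
  refine ⟨fun x => ?_, fun x₀ hx₀ => ?_, fun x hx => ?_, fun x => ?_⟩
  · have h1 := solution_ge_exp hf hε hu hA₀0 hexp_am ht0 x
    have h2 : (0 * x + (0 ^ 2 - p / ε) * t) = (-p) / ε * t := by ring
    rw [h2, hscale, neg_mul, neg_neg] at h1
    linarith
  · obtain ⟨Y, Y', hY0, hY, hYend⟩ := hflow (a0 + ε ^ β)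
      ⟨by linarith [Real.rpow_pos_of_pos hε β], by linarith [hf.lt_right]⟩
    have ha2 : (ε ^ (-(1 / 2) : ℝ)) ^ 2 = 1 / ε := rpow_neg_half_sq hε
    have h1 := solution_ge_local hf hε hu (x₀ := x₀) (R := ε ^ β / C0) (M := M) ha2
      (by positivity) hM0 (fun τ => ⟨(hY τ).1.2.le, (hY τ).2⟩)
      (fun x hx => by
        have h2 := (abs_le.1 (hv.lipschitz x x₀)).1
        rw [le_div_iff₀' hC0] at hx
        rw [hY0]
        linarith)
      (fun x => by
        have h2 := (abs_le.1 (hv.abs_le x)).1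
        have h3 := abs_nonneg ap
        have h4 := le_abs_self am
        linarith) ht0
    have h2 := hYend (t / ε)
    rw [htε, ← neg_mul, exp_mul_abs_log hε hε1, add_sub_cancel_left, ← Real.rpow_mul hε.le,
      mul_assoc, ← Real.rpow_add hε, ← htε] at h2
    have h3 : β * -(r / (μ / 2)) + -(-r * C1) = r * C1 - β * (r / (μ / 2)) := by ring
    rw [h3] at h2
    rw [hscale] at h1
    have h4 : M / Real.cosh (ε ^ (-(1 / 2) : ℝ) * (ε ^ β / C0)) * ε ^ (-((L + 1) * C1))
        ≤ 2 * M * ε ^ (-((L + 1) * C1)) * Real.exp (-(C0⁻¹ * ε ^ (-(1 / 2 - β)))) := by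
      have h5 : ε ^ (-(1 / 2) : ℝ) * (ε ^ β / C0) = C0⁻¹ * ε ^ (-(1 / 2 - β)) := by
        have : -(1 / 2 - β) = -(1 / 2) + β := by ring
        rw [this, Real.rpow_add hε]
        field_simp
      rw [h5]
      set y := C0⁻¹ * ε ^ (-(1 / 2 - β))
      have h6 : Real.exp y / 2 ≤ Real.cosh y := by
        rw [Real.cosh_eq]
        linarith [Real.exp_pos (-y)]
      have h7 : M / Real.cosh y ≤ 2 * M * Real.exp (-y) := by
        calc M / Real.cosh y ≤ M / (Real.exp y / 2) :=
              div_le_div_of_nonneg_left hM0 (by positivity) h6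
          _ = _ := by rw [Real.exp_neg]; field_simp
      calc _ ≤ 2 * M * Real.exp (-y) * ε ^ (-((L + 1) * C1)) :=
            mul_le_mul_of_nonneg_right h7 (by positivity)
        _ = _ := by ring
    linarith
  · have ha2 : (ε ^ (-(1 / 2) : ℝ)) ^ 2 = 1 / ε := rpow_neg_half_sq hε
    set a := ε ^ (-(1 / 2) : ℝ)
    have ha0 : 0 ≤ a := by positivity
    have hkr : k ^ 2 ≤ r / ε := by
      rw [lt_div_iff₀ (by positivity)] at hεr
      rw [le_div_iff₀ hε]
      linarith
    have h1 := solution_ge_right hf hε hu ha0 ha2 hh.le hk hL hhrate hkr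
      (fun y hy => by
        refine le_trans ?_ (hv.right y hy)
        have h2 : ε * Real.exp (-(k * y)) ≤ h * Real.exp (-k * y + k) :=
          mul_le_mul hεh.le (Real.exp_le_exp.2 (by linarith)) (Real.exp_pos _).le hh.le
        linarith) ht0 (M := M)
      (fun s hs y => by
        have := hall s hs.1 y
        have := abs_nonneg ap
        linarith) hM0 x
    have h2 : h * Real.exp (-k * x + (k + (k ^ 2 - r / ε) * t))
        ≤ Real.exp (k + 1) * ε ^ κ * Real.exp (-(k * x)) := by
      rw [Real.exp_add, Real.exp_add, Real.exp_add, neg_mul]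
      calc _ ≤ 1 * (Real.exp (-(k * x)) * (Real.exp k * (Real.exp 1 * ε ^ κ))) := by
            gcongr
            exact hdecay r hC1κ.le
        _ = _ := by ring
    have h3 : M * Real.exp (-a * x + (a + (L + 1) / ε * t))
        ≤ ε ^ κ * Real.exp (-(k * x)) := by
      have h4 : Real.exp (-a * x + a) ≤ Real.exp (-(1 / 2 * a)) * Real.exp (-(k * x)) := by
        rw [← Real.exp_add]
        refine Real.exp_le_exp.2 ?_
        have h5 : 0 ≤ x - 2 := sub_nonneg.2 hx
        linarith [mul_nonneg (sub_nonneg.2 hεk) (by linarith : 0 ≤ x - 2 + 1 / 2),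
          mul_nonneg hk h5]
      rw [← add_assoc, Real.exp_add, hscale]
      calc M * (Real.exp (-a * x + a) * ε ^ (-((L + 1) * C1)))
          ≤ M * (Real.exp (-(1 / 2 * a)) * Real.exp (-(k * x)) * ε ^ (-((L + 1) * C1))) := by
            gcongr
        _ = M * ε ^ (-((L + 1) * C1)) * Real.exp (-(1 / 2 * a)) * Real.exp (-(k * x)) := by ring
        _ ≤ _ := mul_le_mul_of_nonneg_right hεM' (by positivity)
    have h5 : 0 ≤ A₁ * Real.exp 1 * ε ^ κ * Real.exp (-(k * x)) := by positivity
    linarith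
  · have h1 := solution_ge_exp hf hε hu (A := A₁) (k := k) (by positivity)
      (fun y => by
        rcases le_total y (-1) with hy | hy
        · refine le_trans ?_ (hv.left y hy)
          have h2 : ε ≤ A₁ := by
            have : 1 ≤ A₁ := one_le_mul_of_one_le_of_one_le (by linarith) (Real.one_le_exp hk)
            linarith
          linarith [mul_le_mul_of_nonneg_right h2 (Real.exp_pos (k * y)).le]
        · have h2 : A₀ ≤ A₁ * Real.exp (k * y) := by
            rw [hA₁, mul_assoc, ← Real.exp_add]
            have h3 : 1 ≤ Real.exp (k + k * y) := Real.one_le_exp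
              (by linarith [mul_le_mul_of_nonneg_left hy hk])
            linarith [le_mul_of_one_le_right (by linarith : 0 ≤ A₀ + 1) h3]
          have := hexp_am y
          simp only [zero_mul, Real.exp_zero, mul_one] at this
          linarith) ht0 x
    refine le_trans ?_ h1
    rw [Real.exp_add (k * x)]
    have h2 : A₁ * (Real.exp (k * x) * Real.exp ((k ^ 2 - p / ε) * t))
        ≤ A₁ * (Real.exp (k * x) * (Real.exp 1 * ε ^ κ)) := by
      gcongr
      exact hdecay p hC1p.le
    have h3 : 0 ≤ (Real.exp (k + 1) + 1) * ε ^ κ * Real.exp (k * x) := by positivity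
    linarith

/-! ### Reflection -/

lemma lowerReaction_of_deriv_le {f : ℝ → ℝ} {am a0 ap p μ L : ℝ} (hd : Differentiable ℝ f)
    (hma : am < a0) (hap : a0 < ap) (hp : 0 < p) (hμ : 0 < μ)
    (hz : ∀ v, f v = 0 ↔ v = am ∨ v = a0 ∨ v = ap) (ha0 : deriv f a0 = μ)
    (hfap : deriv f ap = -p) (hL : ∀ v, deriv f v ≤ L)
    (hge : ∀ v ≤ am, -p * (v - am) ≤ f v) : LowerReaction f am a0 ap p μ L := by
  have hz0 : f a0 = 0 := (hz a0).2 (Or.inr (Or.inl rfl))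
  have hd0 : HasDerivAt f μ a0 := ha0 ▸ (hd a0).hasDerivAt
  refine ⟨hd.continuous, hma, hap, hp, hμ,
    fun _ _ h => image_sub_le_mul_sub_of_deriv_le hd hL h, fun v hv => ?_, hz0,
    (hz ap).2 (Or.inr (Or.inr rfl)), hd0, hfap ▸ (hd ap).hasDerivAt, hge⟩
  -- `f` is positive just above `a0`, and has no zero in `(a0, ap)`.
  have h1 : ∀ᶠ w in 𝓝[>] a0, 0 < slope f a0 w :=
    (hd0.tendsto_slope.mono_left
      (nhdsWithin_mono _ fun s hs => ne_of_gt hs)).eventually (lt_mem_nhds hμ)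
  obtain ⟨w, hw, hw'⟩ := (h1.and (Ioo_mem_nhdsGT hv.1)).exists
  have hfw : 0 < f w := by
    rw [slope_def_field, hz0, sub_zero] at hw
    exact (div_pos_iff_of_pos_right (sub_pos.2 hw'.1)).1 hw
  by_contra! hneg
  obtain ⟨y, hy, hfy⟩ := intermediate_value_Icc' hw'.2.le hd.continuous.continuousOn
    (show (0 : ℝ) ∈ Icc (f v) (f w) from ⟨hneg, hfw.le⟩)
  have hy1 := hma
  have hy2 := hw'.1
  have hy3 := hv.2
  rcases (hz y).1 hfy with h | h | h <;> linarith [hy.1, hy.2]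

lemma IsBistable.lowerReaction {f : ℝ → ℝ} {am a0 ap p μ : ℝ} (hf : IsBistable f am a0 ap p μ) :
    ∃ L, 0 ≤ L ∧ LowerReaction f am a0 ap p μ L := by
  obtain ⟨L, hL, hfL⟩ := hf.deriv_le
  exact ⟨L, hL.le, lowerReaction_of_deriv_le (hf.contDiff.differentiable (by norm_num))
    hf.lt_left hf.lt_right hf.p_pos hf.mu_pos hf.zeros hf.deriv_a0 hf.deriv_ap hfL hf.ge_of_le⟩

lemma deriv_neg_comp_neg (g : ℝ → ℝ) :
    deriv (fun x => -g (-x)) = fun x => deriv g (-x) := by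
  funext x
  rw [deriv.fun_neg, deriv_comp_neg, neg_neg]

lemma deriv_deriv_neg_comp_neg (g : ℝ → ℝ) :
    deriv (deriv fun x => -g (-x)) = fun x => -deriv (deriv g) (-x) := by
  rw [deriv_neg_comp_neg]
  funext x
  exact deriv_comp_neg _ _

lemma contDiff_neg_comp_neg {g : ℝ → ℝ} {n : WithTop ℕ∞} (hg : ContDiff ℝ n g) :
    ContDiff ℝ n fun x => -g (-x) :=
  (hg.comp contDiff_neg).neg

lemma IsBistable.lowerReaction_reflect {f : ℝ → ℝ} {am a0 ap p μ : ℝ}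
    (hf : IsBistable f am a0 ap p μ) :
    ∃ L, 0 ≤ L ∧ LowerReaction (fun v => -f (-v)) (-ap) (-a0) (-am) p μ L := by
  obtain ⟨L, hL, hfL⟩ := hf.deriv_le
  refine ⟨L, hL.le, lowerReaction_of_deriv_le
    ((contDiff_neg_comp_neg hf.contDiff).differentiable (by norm_num))
    (neg_lt_neg hf.lt_right) (neg_lt_neg hf.lt_left) hf.p_pos hf.mu_pos (fun v => ?_)
    ?_ ?_ (fun v => ?_) fun v hv => ?_⟩
  · rw [neg_eq_zero, hf.zeros, neg_eq_iff_eq_neg, neg_eq_iff_eq_neg, neg_eq_iff_eq_neg]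
    tauto
  · simp only [deriv_neg_comp_neg, neg_neg, hf.deriv_a0]
  · simp only [deriv_neg_comp_neg, neg_neg, hf.deriv_am]
  · rw [deriv_neg_comp_neg]
    exact hfL _
  · linarith [hf.le_of_ge (-v) (le_neg.1 hv)]

lemma IsAllenCahnSolution.reflect {f : ℝ → ℝ} {ε : ℝ} {v : ℝ → ℝ} {u : ℝ → ℝ → ℝ}
    (hu : IsAllenCahnSolution f ε v u) :
    IsAllenCahnSolution (fun w => -f (-w)) ε (fun x => -v (-x)) (fun t x => -u t (-x)) where
  continuousOn := by
    have h : ContinuousOn (fun q : ℝ × ℝ => (q.1, -q.2)) (Ici (0 : ℝ) ×ˢ univ) := by fun_prop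
    exact (hu.continuousOn.comp h fun q hq => ⟨hq.1, mem_univ _⟩).neg
  bounded T := by
    obtain ⟨M, hM⟩ := hu.bounded T
    exact ⟨M, fun t ht x => by rw [abs_neg]; exact hM t ht _⟩
  initial x := by rw [hu.initial]
  contDiff t ht := contDiff_neg_comp_neg (hu.contDiff t ht)
  equation t ht x := by
    rw [deriv_deriv_neg_comp_neg]
    refine (hu.equation t ht (-x)).neg.congr_deriv ?_
    simp only [neg_neg]
    ring

lemma abs_sub_le_of_abs_deriv_le {v : ℝ → ℝ} {C : ℝ} (hv : Differentiable ℝ v)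
    (h : ∀ x, |deriv v x| ≤ C) (x y : ℝ) : |v x - v y| ≤ C * |x - y| :=
  Convex.norm_image_sub_le_of_norm_deriv_le (fun z _ => hv z) (fun z _ => h z) convex_univ
    (mem_univ y) (mem_univ x)

section initial_value

variable {am a0 ap μ C0 C C' κ ξ0 ε : ℝ} {v : ℝ → ℝ}

lemma rpow_mul_min_le (hε : 0 < ε) (hε1 : ε < 1) (hκ : 1 < κ) (hμ : 0 < μ) :
    ε ^ κ * min (μ / 4) 1 ≤ ε := by
  have h1 : ε ^ κ ≤ ε := by
    simpa using Real.rpow_le_rpow_of_exponent_ge hε hε1.le hκ.le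
  calc ε ^ κ * min (μ / 4) 1 ≤ ε * 1 :=
        mul_le_mul h1 (min_le_right _ _) (by positivity) hε.le
    _ = ε := mul_one ε

lemma IsInitialValue.abs_le (hv : IsInitialValue am a0 ap μ C0 C C' κ ξ0 ε v) (x : ℝ) :
    |v x| ≤ C0 := by
  linarith [hv.bound x x x, abs_nonneg (deriv v x), abs_nonneg (deriv (deriv v) x)]

lemma IsInitialValue.abs_sub_le (hv : IsInitialValue am a0 ap μ C0 C C' κ ξ0 ε v) (x y : ℝ) :
    |v x - v y| ≤ C0 * |x - y| :=
  abs_sub_le_of_abs_deriv_le (hv.contDiff.differentiable (by norm_num))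
    (fun z => by linarith [hv.bound z z z, abs_nonneg (v z), abs_nonneg (deriv (deriv v) z)]) x y

lemma IsInitialValue.abs_sub_right (hv : IsInitialValue am a0 ap μ C0 C C' κ ξ0 ε v)
    (hε : 0 < ε) (hε1 : ε < 1) (hκ : 1 < κ) (hμ : 0 < μ) {x : ℝ} (hx : 1 ≤ x) :
    |v x - ap| ≤ ε * Real.exp (-(√μ / 2 * x)) := by
  have h1 := hv.right x hx
  have h2 := mul_le_mul_of_nonneg_right (rpow_mul_min_le hε hε1 hκ hμ)
    (Real.exp_pos (-(√μ * x / 2))).le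
  have h3 : √μ / 2 * x = √μ * x / 2 := by ring
  rw [h3]
  linarith [abs_nonneg (deriv v x), abs_nonneg (deriv (deriv v) x)]

lemma IsInitialValue.abs_sub_left (hv : IsInitialValue am a0 ap μ C0 C C' κ ξ0 ε v)
    (hε : 0 < ε) (hε1 : ε < 1) (hκ : 1 < κ) (hμ : 0 < μ) {x : ℝ} (hx : x ≤ -1) :
    |v x - am| ≤ ε * Real.exp (√μ / 2 * x) := by
  have h1 := hv.left x hx
  have h2 := mul_le_mul_of_nonneg_right (rpow_mul_min_le hε hε1 hκ hμ)
    (Real.exp_pos (√μ * x / 2)).le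
  have h3 : √μ / 2 * x = √μ * x / 2 := by ring
  rw [h3]
  linarith [abs_nonneg (deriv v x), abs_nonneg (deriv (deriv v) x)]

lemma IsInitialValue.lowerInitial (hv : IsInitialValue am a0 ap μ C0 C C' κ ξ0 ε v)
    (hε : 0 < ε) (hε1 : ε < 1) (hκ : 1 < κ) (hμ : 0 < μ) :
    LowerInitial am ap (√μ / 2) C0 ε v where
  abs_le := hv.abs_le
  lipschitz := hv.abs_sub_le
  right x hx := by linarith [(_root_.abs_le.1 (hv.abs_sub_right hε hε1 hκ hμ hx)).1]
  left x hx := by linarith [(_root_.abs_le.1 (hv.abs_sub_left hε hε1 hκ hμ hx)).1]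

lemma IsInitialValue.lowerInitial_reflect (hv : IsInitialValue am a0 ap μ C0 C C' κ ξ0 ε v)
    (hε : 0 < ε) (hε1 : ε < 1) (hκ : 1 < κ) (hμ : 0 < μ) :
    LowerInitial (-ap) (-am) (√μ / 2) C0 ε (fun x => -v (-x)) where
  abs_le x := by rw [abs_neg]; exact hv.abs_le _
  lipschitz x y := by simpa only [neg_sub_neg] using hv.abs_sub_le (-y) (-x)
  right x hx := by
    have h := (_root_.abs_le.1
      (hv.abs_sub_left hε hε1 hκ hμ (neg_le_neg hx))).2
    rw [mul_neg] at h
    linarith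
  left x hx := by
    have h := (_root_.abs_le.1
      (hv.abs_sub_right hε hε1 hκ hμ (le_neg.1 hx : (1 : ℝ) ≤ -x))).2
    rw [mul_neg, neg_neg] at h
    linarith

end initial_value

theorem mainTheorem2
    (f : ℝ → ℝ) (am a0 ap p μ : ℝ) (hf : IsBistable f am a0 ap p μ) (hpμ : μ < 2 * p)
    (C0 c c' κ0 ξ0 ε1 : ℝ) (hC0 : 1 < C0) (hc : 0 < c) (hc' : 0 < c') (hκ0 : 1 < κ0)
    (hε1 : 0 < ε1)
    (u0 : ℝ → ℝ → ℝ)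
    (hu0 : ∀ ε ∈ Ioo 0 ε1, IsInitialValue am a0 ap μ C0 c c' κ0 ξ0 ε (u0 ε))
    (u : ℝ → ℝ → ℝ → ℝ)
    (hu : ∀ ε ∈ Ioo 0 ε1, IsAllenCahnSolution f ε (u0 ε) (u ε)) :
    ∃ K κ C Ct : ℝ, 1 < K ∧ 1 / 2 < κ ∧ 0 < C ∧ 0 < Ct ∧
      ∃ Cmin ∈ Ioo 0 (1 / μ), ∀ C1 ∈ Ioo Cmin (1 / μ), ∀ β ∈ Ioo 0 (1 - C1 * μ),
        ∃ ε0 ∈ Ioo 0 ε1, ∀ ε ∈ Ioc 0 ε0,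
          (∀ x ∈ Icc (-K) K,
            am - ε ^ κ ≤ u ε (C1 * ε * |Real.log ε|) x ∧
              u ε (C1 * ε * |Real.log ε|) x ≤ ap + ε ^ κ) ∧
          (∀ x ∈ Icc (-K) K, a0 + C * ε ^ β ≤ u0 ε x →
            ap - ε ^ κ ≤ u ε (C1 * ε * |Real.log ε|) x) ∧
          (∀ x ∈ Icc (-K) K, u0 ε x ≤ a0 - C * ε ^ β →
            u ε (C1 * ε * |Real.log ε|) x ≤ am + ε ^ κ) ∧
          (∀ x : ℝ, K ≤ x →
            |u ε (C1 * ε * |Real.log ε|) x - ap|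
              ≤ Ct * ε ^ κ * Real.exp (-(Real.sqrt μ * x / 2))) ∧
          (∀ x : ℝ, x ≤ -K →
            |u ε (C1 * ε * |Real.log ε|) x - am|
              ≤ Ct * ε ^ κ * Real.exp (Real.sqrt μ * x / 2)) := by
  have hμ := hf.mu_pos
  -- Since `μ < 2 p`, there are `κ > 1 / 2` and a rate `r < p` with `κ μ < r`.
  obtain ⟨r, hr, hrp⟩ := exists_between (show μ / 2 < p by linarith)
  obtain ⟨κ, hκ, hκr⟩ := exists_between (show 1 / 2 < r / μ by
    rw [div_lt_div_iff₀ two_pos hμ]; linarith)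
  rw [lt_div_iff₀ hμ] at hκr
  have hκ0' : 0 < κ := by linarith
  have hr0 : 0 < r := by linarith
  have hk : 0 ≤ √μ / 2 := by positivity
  have hkμ : (√μ / 2) ^ 2 ≤ μ := by
    rw [div_pow, Real.sq_sqrt hμ.le]; linarith
  obtain ⟨L, hL, hfL⟩ := hf.lowerReaction
  obtain ⟨L', hL', hfL'⟩ := hf.lowerReaction_reflect
  obtain ⟨Ct, hCt, H⟩ := eventually_lower_bounds hfL hL hκ0' hκr hrp hk hkμ (by linarith : 0 < C0)
  obtain ⟨Ct', hCt', H'⟩ :=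
    eventually_lower_bounds hfL' hL' hκ0' hκr hrp hk hkμ (by linarith : 0 < C0)
  refine ⟨2, κ, 2, max Ct Ct', one_lt_two, hκ, two_pos, lt_max_of_lt_left hCt,
    (2 / μ + κ / r) / 3, ⟨by positivity, ?_⟩, fun C1 hC1 β hβ => ?_⟩
  · have h1 : κ / r < 1 / μ := by rw [div_lt_div_iff₀ hr0 hμ]; linarith
    have h2 : 2 / μ = 2 * (1 / μ) := by ring
    linarith
  have hεev : ∀ᶠ ε : ℝ in 𝓝[>] 0, ε ∈ Ioo 0 ε1 ∧ ε ∈ Ioo 0 1 :=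
    (eventually_mem_set.2 (Ioo_mem_nhdsGT hε1)).and (Ioo_mem_nhdsGT one_pos)
  have key := H C1 hC1 β hβ u0 u (hεev.mono fun ε hε =>
    ⟨(hu0 ε hε.1).lowerInitial hε.1.1 hε.2.2 hκ0 hμ, hu ε hε.1⟩)
  have key' := H' C1 hC1 β hβ (fun ε x => -u0 ε (-x)) (fun ε t x => -u ε t (-x))
    (hεev.mono fun ε hε =>
      ⟨(hu0 ε hε.1).lowerInitial_reflect hε.1.1 hε.2.2 hκ0 hμ, (hu ε hε.1).reflect⟩)
  obtain ⟨b, hb, hb'⟩ := mem_nhdsGT_iff_exists_Ioo_subset.1 (key.and key')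
  have hb : 0 < b := hb
  refine ⟨min b ε1 / 2, ⟨by positivity, by linarith [min_le_right b ε1]⟩, fun ε hε => ?_⟩
  obtain ⟨⟨h1, h2, h3, h4⟩, h1', h2', h3', h4'⟩ :=
    hb' (show ε ∈ Ioo 0 b from ⟨hε.1, by linarith [hε.2, min_le_left b ε1]⟩)
  have hεκ : 0 < ε ^ κ := Real.rpow_pos_of_pos hε.1 κ
  have hmax : ∀ y, Ct * ε ^ κ * Real.exp y ≤ max Ct Ct' * ε ^ κ * Real.exp y := fun y => by
    gcongr; exact le_max_left _ _
  have hmax' : ∀ y, Ct' * ε ^ κ * Real.exp y ≤ max Ct Ct' * ε ^ κ * Real.exp y := fun y => by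
    gcongr; exact le_max_right _ _
  have hcomm : ∀ x, √μ / 2 * x = √μ * x / 2 := fun x => by ring
  simp only [hcomm] at h3 h4 h3' h4'
  refine ⟨fun x _ => ⟨h1 x, ?_⟩, fun x _ hx => h2 x hx, fun x _ hx => ?_, fun x hx => ?_,
    fun x hx => ?_⟩
  · have := h1' (-x)
    rw [neg_neg] at this
    linarith
  · have := h2' (-x)
    rw [neg_neg] at this
    linarith [this (by linarith)]
  · have hlow := h3 x hx
    have hup := h4' (-x)
    rw [neg_neg, mul_neg, neg_div] at hup
    rw [abs_le]
    constructor <;> linarith [hmax (-(√μ * x / 2)), hmax' (-(√μ * x / 2))]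
  · have hlow := h4 x
    have hup := h3' (-x) (by linarith)
    rw [neg_neg, mul_neg, neg_div, neg_neg] at hup
    rw [abs_le]
    constructor <;> linarith [hmax (√μ * x / 2), hmax' (√μ * x / 2)]
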